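/- A \emph{KTB-algebra} is an algebra $\langle A;\vee,\wedge,\neg,\Diamond,0,1\rangle$ such that $\langle A;\vee,\wedge,\neg,0,1\rangle$ is a Boolean algebra and, for all $x,y\in A$, $\Diamond 0=0$, $\Diamond(x\vee y)=\Diamond x\vee\Diamond y$, $x\le\Diamond x$ and $x\le\neg\Diamond\neg\Diamond x$. For a class $\mathcal C$ of KTB-algebras let $\operatorname{Var}(\mathcal C)=\mathrm{HSP}(\mathcal C)$ be the variety it generates, i.e. the class of all homomorphic images of subalgebras of direct products of (possibly empty) families of members of $\mathcal C$; write $\operatorname{Var}(\mathbf A)$ for $\operatorname{Var}(\{\mathbf A\})$. Let $\mathbb E$ be the set of positive even integers, and let $W=\{a,b_1,b_2,b_3,c_1,c_2,d\}\cup\{u_i\mid i\ge 1\}\cup\{\ell_i\mid i\ge 0\}$, all the listed elements being distinct. For $N\subseteq\mathbb E$ let $R_N$ be the reflexive symmetric relation on $W$ such that, for $x\neq y$, $x\mathrel{R_N}y$ holds if and only if $\{x,y\}$ is one of the following pairs: \begin{itemize} \item $\{a,b_i\}$ with $i\in\{1,2,3\}$; $\{b_i,c_i\}$ with $i\in\{1,2\}$;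 $\{c_1,d\}$; $\{\ell_0,\ell_1\}$; \item $\{a,\ell_i\}$ with $i\ge 0$; $\{\ell_i,u_i\}$ with $i\ge 1$; $\{\ell_i,u_{i-1}\}$ with $i\in\mathbb E$; \item $\{\ell_i,u_{i+1}\}$ with $i\in N$; $\{\ell_{i+1},u_i\}$ with $i\in\mathbb E\setminus N$. \end{itemize} The power set of $W$, with the set-theoretic Boolean operations and $\Diamond_N X=\{x\in W\mid x\mathrel{R_N}y\text{ for some }y\in X\}$, is a KTB-algebra $\mathsf{Cm}(\mathbb F_N)$ (the complex algebra of the graph $\mathbb F_N=\langle W;R_N\rangle$). Let $\mathbf D_N$ be the subalgebra of $\mathsf{Cm}(\mathbb F_N)$ generated by the element $D=\{d\}$. \textbf{Lemma.} Let $M,N\subseteq\mathbb E$ with $M\neq N$. Then $\operatorname{Var}(\mathbf D_M)\neq\operatorname{Var}(\mathbf D_N)$. -/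

import Mathlib

universe u

/-! ### KTB-algebras, homomorphisms, subalgebras, products -/

/-- A KTB-algebra: a Boolean algebra with a unary operation `dia` (diamond) such that
`◇0 = 0`, `◇(x ∨ y) = ◇x ∨ ◇y`, `x ≤ ◇x` and `x ≤ □◇x`, where `□ = ¬◇¬`. -/
class KTBAlgebra (A : Type u) extends BooleanAlgebra A where
  dia : A → A
  dia_bot : dia ⊥ = ⊥
  dia_sup : ∀ x y : A, dia (x ⊔ y) = dia x ⊔ dia y
  le_dia : ∀ x : A, x ≤ dia x
  le_box_dia : ∀ x : A, x ≤ (dia (dia x)ᶜ)ᶜ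

/-- Homomorphisms of KTB-algebras: maps preserving `∨, ∧, 0, 1` (hence also `¬`) and `◇`. -/
structure KTBHom (A B : Type u) [KTBAlgebra A] [KTBAlgebra B] extends
    BoundedLatticeHom A B where
  map_dia' : ∀ x : A, toFun (KTBAlgebra.dia x) = KTBAlgebra.dia (toFun x)

/-- Subalgebras of a KTB-algebra: subsets closed under `∨, ∧, ¬, 0, 1` and `◇`. -/
structure KTBSubalgebra (A : Type u) [KTBAlgebra A] extends BooleanSubalgebra A where
  dia_mem' : ∀ {x : A}, x ∈ carrier → KTBAlgebra.dia x ∈ carrier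

/-- A subalgebra is a KTB-algebra under the restricted operations. -/
instance KTBSubalgebra.instKTBAlgebra {A : Type u} [KTBAlgebra A] (L : KTBSubalgebra A) :
    KTBAlgebra L.toBooleanSubalgebra where
  dia x := ⟨KTBAlgebra.dia x.1, L.dia_mem' x.2⟩
  dia_bot := Subtype.ext KTBAlgebra.dia_bot
  dia_sup x y := Subtype.ext (KTBAlgebra.dia_sup x.1 y.1)
  le_dia x := KTBAlgebra.le_dia x.1
  le_box_dia x := KTBAlgebra.le_box_dia x.1

/-- The subalgebra generated by a set: the intersection of all subalgebras containing it. -/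
def KTBSubalgebra.closure {A : Type u} [KTBAlgebra A] (s : Set A) : KTBSubalgebra A where
  carrier := {x | ∀ L : KTBSubalgebra A, s ⊆ L.carrier → x ∈ L.carrier}
  supClosed' := fun _ hx _ hy L hL => L.supClosed' (hx L hL) (hy L hL)
  infClosed' := fun _ hx _ hy L hL => L.infClosed' (hx L hL) (hy L hL)
  compl_mem' := fun hx L hL => L.compl_mem' (hx L hL)
  bot_mem' := fun L _ => L.bot_mem'
  dia_mem' := fun hx L hL => L.dia_mem' (hx L hL)

/-- The direct product of a family of KTB-algebras, with coordinatewise operations. -/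
instance Pi.instKTBAlgebra {I : Type u} (A : I → Type u) [∀ i, KTBAlgebra (A i)] :
    KTBAlgebra (∀ i, A i) where
  dia x := fun i => KTBAlgebra.dia (x i)
  dia_bot := funext fun _ => KTBAlgebra.dia_bot
  dia_sup x y := funext fun i => KTBAlgebra.dia_sup (x i) (y i)
  le_dia x := fun i => KTBAlgebra.le_dia (x i)
  le_box_dia x := fun i => KTBAlgebra.le_box_dia (x i)

/-! ### The class operators `H`, `S`, `P` and `Var = HSP` -/

/-- A bundled KTB-algebra. A class of KTB-algebras is a `Set KTBAlg`. -/
structure KTBAlg : Type (u + 1) where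
  carrier : Type u
  [str : KTBAlgebra carrier]

attribute [instance] KTBAlg.str

namespace KTBAlg

/-- Homomorphic images of members of `C`. -/
def H (C : Set KTBAlg.{u}) : Set KTBAlg.{u} :=
  {B | ∃ A ∈ C, ∃ f : KTBHom A.carrier B.carrier, Function.Surjective f.toFun}

/-- Subalgebras of members of `C`. -/
def S (C : Set KTBAlg.{u}) : Set KTBAlg.{u} :=
  {B | ∃ A ∈ C, ∃ L : KTBSubalgebra A.carrier, B = ⟨L.toBooleanSubalgebra⟩}

/-- Direct products of (possibly empty) families of members of `C`. -/
def P (C : Set KTBAlg.{u}) : Set KTBAlg.{u} :=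
  {B | ∃ (I : Type u) (F : I → KTBAlg.{u}), (∀ i, F i ∈ C) ∧ B = ⟨∀ i, (F i).carrier⟩}

/-- The variety generated by the class `C`. -/
def Var (C : Set KTBAlg.{u}) : Set KTBAlg.{u} := H (S (P C))

end KTBAlg

/-! ### Complex algebras of graphs -/

/-- The universe of the complex algebra of the graph `G`: all sets of vertices. -/
def Cm {V : Type u} (_G : SimpleGraph V) : Type u := Set V

/-- The complex algebra of the reflexive closure of the adjacency relation of `G`: the Boolean
algebra of all sets of vertices, where `◇X` is the set of all points that are in `X` or
adjacent to a point of `X`. -/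
instance Cm.instKTBAlgebra {V : Type u} (G : SimpleGraph V) : KTBAlgebra (Cm G) where
  toBooleanAlgebra := inferInstanceAs (BooleanAlgebra (Set V))
  dia := fun X : Set V => {x : V | ∃ y ∈ X, x = y ∨ G.Adj x y}
  dia_bot := by
    change {x : V | ∃ y ∈ (∅ : Set V), x = y ∨ G.Adj x y} = (∅ : Set V)
    ext x; simp
  dia_sup := by
    intro (X : Set V) (Y : Set V)
    change {x : V | ∃ y ∈ X ∪ Y, x = y ∨ G.Adj x y} =
      {x : V | ∃ y ∈ X, x = y ∨ G.Adj x y} ∪ {x : V | ∃ y ∈ Y, x = y ∨ G.Adj x y}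
    ext x
    simp only [Set.mem_union, Set.mem_ofPred_eq, or_and_right, exists_or]
  le_dia := fun (X : Set V) x (hx : x ∈ X) => ⟨x, hx, Or.inl rfl⟩
  le_box_dia := by
    intro (X : Set V) x (hx : x ∈ X)
    rintro ⟨y, hy, hxy⟩
    exact hy ⟨x, hx, hxy.imp Eq.symm SimpleGraph.Adj.symm⟩

/-! ### The graphs `F_N` and the algebras `D_N` -/

/-- The set of positive even numbers. -/
def posEven : Set ℕ := {n | 0 < n ∧ Even n}

/-- The vertices `a`, `b₁, b₂, b₃`, `c₁, c₂`, `d`, `uᵢ` (`i ≥ 1`) and `ℓᵢ` (`i ≥ 0`). -/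
inductive Vert : Type
  | a | b₁ | b₂ | b₃ | c₁ | c₂ | d
  | u (i : ℕ) (hi : 0 < i)
  | l (i : ℕ)

/-- The list of edges of `F_N`, each given in one orientation. -/
inductive EdgeFN (N : Set ℕ) : Vert → Vert → Prop
  | a_b₁ : EdgeFN N .a .b₁
  | a_b₂ : EdgeFN N .a .b₂
  | a_b₃ : EdgeFN N .a .b₃
  | b₁_c₁ : EdgeFN N .b₁ .c₁
  | b₂_c₂ : EdgeFN N .b₂ .c₂
  | c₁_d : EdgeFN N .c₁ .d
  | l_zero_one : EdgeFN N (.l 0) (.l 1)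
  | a_l (i : ℕ) : EdgeFN N .a (.l i)
  | l_u (i : ℕ) (hi : 0 < i) : EdgeFN N (.l i) (.u i hi)
  | l_u_pred (i : ℕ) (hi : i ∈ posEven) (h : 0 < i - 1) : EdgeFN N (.l i) (.u (i - 1) h)
  | l_u_succ (i : ℕ) (hi : i ∈ N) : EdgeFN N (.l i) (.u (i + 1) i.succ_pos)
  | l_succ_u (i : ℕ) (hi : i ∈ posEven \ N) : EdgeFN N (.l (i + 1)) (.u i hi.1.1)

/-- The graph `F_N` (without loops; these are supplied by `Cm`). -/
def graphFN (N : Set ℕ) : SimpleGraph Vert := SimpleGraph.fromRel (EdgeFN N)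

/-- The element `D = {d}` of the complex algebra of `F_N`. -/
def elemD (N : Set ℕ) : Cm (graphFN N) := ({Vert.d} : Set Vert)

/-- The algebra `D_N`: the subalgebra of `Cm(F_N)` generated by `D`. -/
def algD (N : Set ℕ) : KTBAlg.{0} :=
  ⟨(KTBSubalgebra.closure {elemD N}).toBooleanSubalgebra⟩

/-! Varieties are separated by an identity `t = 0` in one variable, which passes to `Var` by
`KTBAlg.eval_eq_bot_of_mem_Var`. Three facts produce it.

The graph has diameter at most five, so five diamonds send every nonempty set to the whole graph
(`diaFN_five_eq_univ`). Thus "if `s = 0` then `w = 0`", elementwise, becomes the identity `w ∧ ¬◇⁵s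
= 0`.

The set `{d}` is recognised by an equation, uniformly in `N` (`termD`, `eq_singleton_d`). Hence `w ∧
¬◇⁵termD = 0` only tests whether `w` vanishes at `d`.

From `d`, terms walk along the ladder of the `ℓᵢ` and `uᵢ`. If `M` and `N` agree below an even `n`,
the same terms define `uₙ₋₁` and `ℓₙ` in both graphs (`Definable.u_l`). At the least `n` where they
differ, the local shape of the ladder shows on which side `n` lies, giving a `w` that is empty for
one graph and not for the other (`Definable.empty_singleton`). -/

/-! ### Unary terms -/

/-- Terms in one variable in the language of KTB-algebras. -/
inductive KTBTerm : Type
  | var : KTBTerm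
  | compl : KTBTerm → KTBTerm
  | inf : KTBTerm → KTBTerm → KTBTerm
  | dia : KTBTerm → KTBTerm

namespace KTBTerm

/-- The value of a term. -/
def eval {A : Type u} [KTBAlgebra A] (x : A) : KTBTerm → A
  | var => x
  | compl t => (eval x t)ᶜ
  | inf s t => eval x s ⊓ eval x t
  | dia t => KTBAlgebra.dia (eval x t)

/-- The difference of two terms. -/
def sdiff (s t : KTBTerm) : KTBTerm := inf s (compl t)

/-- The join of two terms. -/
def sup (s t : KTBTerm) : KTBTerm := compl (inf (compl s) (compl t))

/-- The iterated diamond. -/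
def diaPow : ℕ → KTBTerm → KTBTerm
  | 0, t => t
  | n + 1, t => dia (diaPow n t)

theorem eval_map {A B : Type u} [KTBAlgebra A] [KTBAlgebra B] (f : KTBHom A B) (x : A)
    (t : KTBTerm) : f.toBoundedLatticeHom (t.eval x) = t.eval (f.toBoundedLatticeHom x) := by
  induction t with
  | var => rfl
  | compl t ih => simp only [eval, map_compl', ih]
  | inf s t ihs iht => simp only [eval, map_inf, ihs, iht]
  | dia t ih => exact (f.map_dia' _).trans (congrArg KTBAlgebra.dia ih)

theorem eval_coe {A : Type u} [KTBAlgebra A] (L : KTBSubalgebra A) (x : L.toBooleanSubalgebra)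
    (t : KTBTerm) : ((t.eval x : L.toBooleanSubalgebra) : A) = t.eval (x : A) := by
  induction t with
  | var => rfl
  | compl t ih => exact congrArg (·ᶜ) ih
  | inf s t ihs iht => exact congrArg₂ (· ⊓ ·) ihs iht
  | dia t ih => exact congrArg KTBAlgebra.dia ih

theorem eval_pi {I : Type u} (A : I → Type u) [∀ i, KTBAlgebra (A i)] (x : ∀ i, A i) (i : I)
    (t : KTBTerm) : t.eval x i = t.eval (x i) := by
  induction t with
  | var => rfl
  | compl t ih => exact congrArg (·ᶜ) ih
  | inf s t ihs iht => exact congrArg₂ (· ⊓ ·) ihs iht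
  | dia t ih => exact congrArg KTBAlgebra.dia ih

end KTBTerm

/-- An identity `t = 0` valid in a class is valid in the variety it generates. -/
theorem KTBAlg.eval_eq_bot_of_mem_Var {C : Set KTBAlg.{u}} (t : KTBTerm)
    (hC : ∀ A ∈ C, ∀ x : A.carrier, t.eval x = ⊥) {B : KTBAlg.{u}} (hB : B ∈ KTBAlg.Var C)
    (y : B.carrier) : t.eval y = ⊥ := by
  obtain ⟨_, ⟨_, ⟨I, F, hF, rfl⟩, L, rfl⟩, f, hf⟩ := hB
  obtain ⟨x, rfl⟩ := hf y
  have hx : t.eval x = ⊥ := by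
    apply Subtype.ext
    refine (KTBTerm.eval_coe L x t).trans ?_
    funext i
    exact (KTBTerm.eval_pi _ _ i t).trans (hC _ (hF i) _)
  have := KTBTerm.eval_map f x t
  rw [hx, map_bot] at this
  exact this.symm

theorem KTBAlg.mem_H_S {C : Set KTBAlg.{u}} {A B : KTBAlg.{u}} (hA : A ∈ C)
    (f : KTBHom A.carrier B.carrier) (hf : Function.Surjective f.toFun) : B ∈ H (S C) := by
  obtain ⟨L, hL⟩ : ∃ L : KTBSubalgebra A.carrier, ∀ x, x ∈ L.toBooleanSubalgebra :=
    ⟨⟨⊤, fun _ => trivial⟩, fun _ => trivial⟩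
  exact ⟨⟨L.toBooleanSubalgebra⟩, ⟨A, hA, L, rfl⟩,
    { toFun := fun x => f.toFun x.1
      map_sup' := fun x y => f.map_sup' x.1 y.1
      map_inf' := fun x y => f.map_inf' x.1 y.1
      map_top' := f.map_top'
      map_bot' := f.map_bot'
      map_dia' := fun x => f.map_dia' x.1 },
    fun y => (hf y).elim fun x hx => ⟨⟨x, hL x⟩, hx⟩⟩

theorem KTBAlg.mem_Var_self (A : KTBAlg.{u}) : A ∈ KTBAlg.Var {A} :=
  mem_H_S ⟨PUnit, fun _ => A, fun _ => rfl, rfl⟩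
    { toFun := fun x => x PUnit.unit
      map_sup' := fun _ _ => rfl
      map_inf' := fun _ _ => rfl
      map_top' := rfl
      map_bot' := rfl
      map_dia' := fun _ => rfl } fun y => ⟨fun _ => y, rfl⟩

/-! ### Adjacency in `F_N` -/

/-- The diamond of `Cm(F_N)` on sets of vertices. -/
def diaFN (N : Set ℕ) (X : Set Vert) : Set Vert := {x | ∃ y ∈ X, x = y ∨ (graphFN N).Adj x y}

/-- The adjacency relation of `F_N`, by cases. -/
def adjFN (N : Set ℕ) : Vert → Vert → Prop
  | .a, .b₁ | .b₁, .a | .a, .b₂ | .b₂, .a | .a, .b₃ | .b₃, .a => True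
  | .b₁, .c₁ | .c₁, .b₁ | .b₂, .c₂ | .c₂, .b₂ | .c₁, .d | .d, .c₁ => True
  | .a, .l _ | .l _, .a => True
  | .l i, .l j => i = 0 ∧ j = 1 ∨ i = 1 ∧ j = 0
  | .l i, .u j _ | .u j _, .l i => i = j ∨ (i ∈ posEven ∧ i = j + 1) ∨ (i ∈ N ∧ j = i + 1) ∨
      (j ∈ posEven ∧ j ∉ N ∧ i = j + 1)
  | _, _ => False

theorem adjFN_of_edge {N : Set ℕ} {x y : Vert} (h : EdgeFN N x y) : adjFN N x y := by
  cases h with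
  | l_u_pred i hi h => exact .inr (.inl ⟨hi, by omega⟩)
  | l_succ_u i hi => exact .inr (.inr (.inr ⟨hi.1, hi.2, rfl⟩))
  | _ => simp_all [adjFN]

theorem adjFN_symm {N : Set ℕ} {x y : Vert} (h : adjFN N x y) : adjFN N y x := by
  cases x <;> cases y <;> simp_all [adjFN]
  omega

theorem edge_of_l_u {N : Set ℕ} {i j : ℕ} {hj : 0 < j} (h : adjFN N (.l i) (.u j hj)) :
    EdgeFN N (.l i) (.u j hj) := by
  rcases h with rfl | ⟨hi, rfl⟩ | ⟨hi, rfl⟩ | ⟨h1, h2, rfl⟩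
  · exact .l_u _ _
  · exact .l_u_pred (j + 1) hi hj
  · exact .l_u_succ _ hi
  · exact .l_succ_u _ ⟨h1, h2⟩

theorem edge_or_edge_of_adjFN {N : Set ℕ} {x y : Vert} (h : adjFN N x y) :
    EdgeFN N x y ∨ EdgeFN N y x := by
  cases x <;> cases y <;> first
    | exact absurd h id
    | exact .inl (edge_of_l_u h)
    | exact .inr (edge_of_l_u h)
    | exact .inl (by constructor)
    | exact .inr (by constructor)
    | (rcases h with ⟨rfl, rfl⟩ | ⟨rfl, rfl⟩
       · exact .inl .l_zero_one
       · exact .inr .l_zero_one)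

theorem mem_diaFN {N : Set ℕ} {X : Set Vert} {x : Vert} :
    x ∈ diaFN N X ↔ ∃ y ∈ X, x = y ∨ adjFN N x y := by
  have key (y : Vert) : x = y ∨ (graphFN N).Adj x y ↔ x = y ∨ adjFN N x y := by
    rw [graphFN, SimpleGraph.fromRel_adj]
    constructor
    · rintro (h | ⟨-, h | h⟩)
      exacts [.inl h, .inr (adjFN_of_edge h), .inr (adjFN_symm (adjFN_of_edge h))]
    · rintro (h | h)
      · exact .inl h
      · by_cases hxy : x = y
        exacts [.inl hxy, .inr ⟨hxy, edge_or_edge_of_adjFN h⟩]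
  simp only [diaFN, Set.mem_ofPred_eq, key]

theorem subset_diaFN (N : Set ℕ) (X : Set Vert) : X ⊆ diaFN N X :=
  fun x hx => ⟨x, hx, .inl rfl⟩

theorem mem_diaFN_of_adj {N : Set ℕ} {X : Set Vert} {x y : Vert} (hy : y ∈ X)
    (h : adjFN N x y) : x ∈ diaFN N X := mem_diaFN.2 ⟨y, hy, .inr h⟩

/-- The vertex `a` is a hub: only `d` is at distance three from it. -/
theorem mem_dia_two_of_a_mem {N : Set ℕ} {X : Set Vert} (h : Vert.a ∈ X) {x : Vert}
    (hx : x ≠ .d) : x ∈ diaFN N (diaFN N X) := by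
  have hb {y} (hy : adjFN N y .a) : y ∈ diaFN N X := mem_diaFN_of_adj h hy
  cases x with
  | a => exact subset_diaFN _ _ (subset_diaFN _ _ h)
  | b₁ => exact subset_diaFN _ _ (hb trivial)
  | b₂ => exact subset_diaFN _ _ (hb trivial)
  | b₃ => exact subset_diaFN _ _ (hb trivial)
  | c₁ => exact mem_diaFN_of_adj (hb (y := .b₁) trivial) trivial
  | c₂ => exact mem_diaFN_of_adj (hb (y := .b₂) trivial) trivial
  | d => exact absurd rfl hx
  | u i hi => exact mem_diaFN_of_adj (hb (y := .l i) trivial) (.inl rfl)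
  | l i => exact subset_diaFN _ _ (hb trivial)

theorem mem_dia_three_of_a_mem {N : Set ℕ} {X : Set Vert} (h : Vert.a ∈ X) (x : Vert) :
    x ∈ diaFN N (diaFN N (diaFN N X)) := by
  by_cases hx : x = .d
  · subst hx
    exact mem_diaFN_of_adj (y := .c₁) (mem_dia_two_of_a_mem h nofun) trivial
  · exact subset_diaFN _ _ (mem_dia_two_of_a_mem h hx)

theorem a_mem_dia_two_of_c₂_mem {N : Set ℕ} {X : Set Vert} (h : Vert.c₂ ∈ X) :
    Vert.a ∈ diaFN N (diaFN N X) :=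
  mem_diaFN_of_adj (y := .b₂) (mem_diaFN_of_adj h trivial) trivial

theorem a_mem_dia_two_of_u_mem {N : Set ℕ} {X : Set Vert} {i hi} (h : Vert.u i hi ∈ X) :
    Vert.a ∈ diaFN N (diaFN N X) :=
  mem_diaFN_of_adj (y := .l i) (mem_diaFN_of_adj h (.inl rfl)) trivial

theorem a_mem_dia_two_of_c₁_mem {N : Set ℕ} {X : Set Vert} (h : Vert.c₁ ∈ X) :
    Vert.a ∈ diaFN N (diaFN N X) :=
  mem_diaFN_of_adj (y := .b₁) (mem_diaFN_of_adj h trivial) trivial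

/-- Every vertex is at distance at most five from every other one. -/
theorem diaFN_five_eq_univ {N : Set ℕ} {X : Set Vert} (h : X.Nonempty) :
    diaFN N (diaFN N (diaFN N (diaFN N (diaFN N X)))) = Set.univ := by
  obtain ⟨y, hy⟩ := h
  refine Set.eq_univ_of_forall fun x => ?_
  cases y with
  | a => exact subset_diaFN _ _ (subset_diaFN _ _ (mem_dia_three_of_a_mem hy x))
  | b₁ | b₂ | b₃ | l =>
    exact subset_diaFN _ _ (mem_dia_three_of_a_mem (mem_diaFN_of_adj hy trivial) x)
  | c₁ => exact mem_dia_three_of_a_mem (a_mem_dia_two_of_c₁_mem hy) x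
  | c₂ => exact mem_dia_three_of_a_mem (a_mem_dia_two_of_c₂_mem hy) x
  | u => exact mem_dia_three_of_a_mem (a_mem_dia_two_of_u_mem hy) x
  | d =>
    by_cases hx : x = .d
    · subst hx
      iterate 5 apply subset_diaFN
      exact hy
    · exact mem_dia_two_of_a_mem
        (a_mem_dia_two_of_c₁_mem (mem_diaFN_of_adj (y := .d) hy trivial)) hx

/-- The set `{d}` is the only one with a vertex at distance five from it, and such that every
vertex at distance three from it has a neighbour at distance four. -/
theorem eq_singleton_d {N : Set ℕ} {X : Set Vert}
    (h5 : (diaFN N (diaFN N (diaFN N (diaFN N (diaFN N X)))) \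
      diaFN N (diaFN N (diaFN N (diaFN N X)))).Nonempty)
    (h3 : diaFN N (diaFN N (diaFN N X)) \ diaFN N (diaFN N X) ⊆
      diaFN N (diaFN N (diaFN N (diaFN N (diaFN N X))) \ diaFN N (diaFN N (diaFN N X)))) :
    X = {Vert.d} := by
  obtain ⟨z, hz, hz4⟩ := h5
  have hne : X.Nonempty := by
    by_contra h
    rw [Set.not_nonempty_iff_eq_empty] at h
    subst h
    simp [diaFN] at hz
  -- If `a` were within one step of `X`, all vertices would be within four, contradicting `z`.
  have ha : Vert.a ∉ diaFN N X := fun h => hz4 (mem_dia_three_of_a_mem h z)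
  have hc₁ : Vert.c₁ ∉ X := fun h => by
    by_cases hzd : z = .d
    · subst hzd
      refine hz4 ?_
      iterate 3 apply subset_diaFN
      exact mem_diaFN_of_adj h trivial
    · exact hz4 (mem_dia_two_of_a_mem (a_mem_dia_two_of_c₁_mem h) hzd)
  by_cases hd : Vert.d ∈ X
  · have ha2 : Vert.a ∉ diaFN N (diaFN N X) := fun h => by
      by_cases hzd : z = .d
      · subst hzd
        refine hz4 ?_
        iterate 4 apply subset_diaFN
        exact hd
      · exact hz4 (mem_dia_two_of_a_mem h hzd)
    refine Set.eq_singleton_iff_unique_mem.2 ⟨hd, fun y hy => ?_⟩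
    cases y with
    | a => exact absurd (subset_diaFN _ _ hy) ha
    | b₁ | b₂ | b₃ | l => exact absurd (mem_diaFN_of_adj (x := .a) hy trivial) ha
    | c₁ => exact absurd hy hc₁
    | c₂ => exact absurd (a_mem_dia_two_of_c₂_mem hy) ha2
    | u => exact absurd (a_mem_dia_two_of_u_mem hy) ha2
    | d => rfl
  -- Now `X` consists of `c₂` and vertices `uᵢ` only, so `a` is at distance two and `b₃` at distance
  -- three. But `b₃` is a leaf attached to `a`, so it has no neighbour at distance four, against
  -- `h3`.
  · exfalso
    have ha2 : Vert.a ∈ diaFN N (diaFN N X) := by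
      obtain ⟨y, hy⟩ := hne
      cases y with
      | a => exact absurd (subset_diaFN _ _ hy) ha
      | b₁ | b₂ | b₃ | l => exact absurd (mem_diaFN_of_adj (x := .a) hy trivial) ha
      | c₁ => exact absurd hy hc₁
      | c₂ => exact a_mem_dia_two_of_c₂_mem hy
      | u => exact a_mem_dia_two_of_u_mem hy
      | d => exact absurd hy hd
    have hb : Vert.b₃ ∈ diaFN N (diaFN N (diaFN N X)) := mem_diaFN_of_adj ha2 trivial
    have hb2 : Vert.b₃ ∉ diaFN N (diaFN N X) := fun h => by
      obtain ⟨y, hy, rfl | hxy⟩ := mem_diaFN.1 h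
      · obtain ⟨y, hy, rfl | hxy⟩ := mem_diaFN.1 hy
        · exact ha (mem_diaFN_of_adj hy trivial)
        · cases y <;> first | exact hxy | exact ha (subset_diaFN _ _ hy)
      · cases y <;> first | exact hxy | exact ha hy
    obtain ⟨y, hy, rfl | hxy⟩ := mem_diaFN.1 (h3 ⟨hb, hb2⟩)
    · exact hy.2 hb
    · cases y <;> first | exact hxy | exact hy.2 (subset_diaFN _ _ ha2)

/-! ### The layers of `{d}` -/

/-- The vertices at distance four from `d`. -/
def layerFour : Set Vert := {x | x = .b₂ ∨ x = .b₃ ∨ ∃ i, x = .l i}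

/-- The vertices at distance five from `d`. -/
def layerFive : Set Vert := {x | x = .c₂ ∨ ∃ i hi, x = .u i hi}

theorem diaFN_d (N : Set ℕ) : diaFN N {.d} = {.c₁, .d} := by
  ext x; rw [mem_diaFN]; cases x <;> simp [adjFN]

theorem diaFN_two_d (N : Set ℕ) : diaFN N {.c₁, .d} = {.b₁, .c₁, .d} := by
  ext x; rw [mem_diaFN]; cases x <;> simp [adjFN]

theorem diaFN_three_d (N : Set ℕ) : diaFN N {.b₁, .c₁, .d} = {.a, .b₁, .c₁, .d} := by
  ext x; rw [mem_diaFN]; cases x <;> simp [adjFN]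

theorem diaFN_four_d (N : Set ℕ) : diaFN N {.a, .b₁, .c₁, .d} = layerFiveᶜ := by
  ext x; rw [mem_diaFN]; cases x <;> simp [adjFN, layerFive]
  omega

theorem layerFour_eq : layerFour = layerFiveᶜ \ {.a, .b₁, .c₁, .d} := by
  ext x; cases x <;> simp [layerFour, layerFive]
  omega

theorem diaFN_five_d (N : Set ℕ) : diaFN N layerFiveᶜ = Set.univ := by
  rw [← diaFN_four_d N, ← diaFN_three_d N, ← diaFN_two_d N, ← diaFN_d N]
  exact diaFN_five_eq_univ ⟨_, rfl⟩

/-! ### Pairs of sets that are simultaneously definable from `d` -/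

/-- A single term evaluates to `A` in `Cm(F_M)` and to `B` in `Cm(F_N)`. -/
def Definable (M N : Set ℕ) (A B : Set Vert) : Prop :=
  ∃ t : KTBTerm, t.eval (elemD M) = A ∧ t.eval (elemD N) = B

namespace Definable

variable {M N : Set ℕ} {A B A' B' : Set Vert}

theorem d : Definable M N {.d} {.d} := ⟨.var, rfl, rfl⟩

theorem compl (h : Definable M N A B) : Definable M N Aᶜ Bᶜ := by
  obtain ⟨t, rfl, rfl⟩ := h
  exact ⟨.compl t, rfl, rfl⟩

theorem inter (h : Definable M N A B) (h' : Definable M N A' B') :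
    Definable M N (A ∩ A') (B ∩ B') := by
  obtain ⟨t, rfl, rfl⟩ := h
  obtain ⟨t', rfl, rfl⟩ := h'
  exact ⟨.inf t t', rfl, rfl⟩

theorem diff (h : Definable M N A B) (h' : Definable M N A' B') :
    Definable M N (A \ A') (B \ B') := h.inter h'.compl

theorem dia (h : Definable M N A B) : Definable M N (diaFN M A) (diaFN N B) := by
  obtain ⟨t, rfl, rfl⟩ := h
  exact ⟨.dia t, rfl, rfl⟩

theorem dia_three_d : Definable M N {.a, .b₁, .c₁, .d} {.a, .b₁, .c₁, .d} := by
  have := (d (M := M) (N := N)).dia.dia.dia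
  rwa [diaFN_d, diaFN_two_d, diaFN_three_d, diaFN_d, diaFN_two_d, diaFN_three_d] at this

theorem layerFive : Definable M N layerFive layerFive := by
  have := (dia_three_d (M := M) (N := N)).dia.compl
  rwa [diaFN_four_d, diaFN_four_d, compl_compl] at this

theorem layerFour : Definable M N layerFour layerFour := by
  rw [layerFour_eq]
  exact layerFive.compl.diff dia_three_d

end Definable

/-! ### The successive definitions of the vertices `ℓᵢ` and `uᵢ` -/

/-- The neighbours of `ℓₙ` among the `uᵢ` other than `uₙ₋₁`, for even `n`. -/
def newU (N : Set ℕ) (n : ℕ) (h : 0 < n - 1) : Set Vert :=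
  (diaFN N {.l n} ∩ layerFive) \ {.u (n - 1) h}

/-- The neighbours of `newU` among the `ℓᵢ` other than `ℓₙ`. -/
def newL (N : Set ℕ) (n : ℕ) (h : 0 < n - 1) : Set Vert :=
  (diaFN N (newU N n h) ∩ layerFour) \ {.l n}

section Steps

variable {N : Set ℕ} {n : ℕ}

/-- For even `n`, the rung from `ℓₙ` to `uₙ₊₁` exists exactly when `n ∈ N`. -/
theorem newU_of_mem (hn : Even n) (hN : n ∈ N) (h : 0 < n - 1) :
    newU N n h = {.u n (by omega), .u (n + 1) (by omega)} := by
  ext x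
  rw [newU, Set.mem_sdiff, Set.mem_inter_iff, mem_diaFN]
  cases x <;> simp [adjFN, layerFive, posEven]
  grind

theorem newU_of_notMem (hn : Even n) (hN : n ∉ N) (h : 0 < n - 1) :
    newU N n h = {.u n (by omega)} := by
  ext x
  rw [newU, Set.mem_sdiff, Set.mem_inter_iff, mem_diaFN]
  cases x <;> simp [adjFN, layerFive, posEven]
  grind

/-- Here `uₙ` has no `ℓ`-neighbour but `ℓₙ`; both new vertices are reached through `uₙ₊₁`, the
second because `n + 2` is even. -/
theorem newL_of_mem (hNE : N ⊆ posEven) (hn : Even n) (hN : n ∈ N) (h : 0 < n - 1) :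
    newL N n h = {.l (n + 1), .l (n + 2)} := by
  have hE {i} (hi : i ∈ N) : Even i := (hNE hi).2
  ext x
  rw [newL, newU_of_mem hn hN, Set.mem_sdiff, Set.mem_inter_iff, mem_diaFN]
  cases x <;> simp [adjFN, layerFour, posEven]
  grind

theorem newL_of_notMem (hNE : N ⊆ posEven) (hn : Even n) (hN : n ∉ N) (h : 0 < n - 1) :
    newL N n h = {.l (n + 1)} := by
  have hE {i} (hi : i ∈ N) : Even i := (hNE hi).2
  ext x
  rw [newL, newU_of_notMem hn hN, Set.mem_sdiff, Set.mem_inter_iff, mem_diaFN]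
  cases x <;> simp [adjFN, layerFour, posEven]
  grind

/-- This and the next lemma detect whether `n ∈ N`: the edge from `uₙ` to `ℓₙ₊₁` is present only
when `n ∉ N`, so `uₙ` survives here and disappears there. -/
theorem newU_diff_of_mem (hNE : N ⊆ posEven) (hn : Even n) (hN : n ∈ N) (h : 0 < n - 1) :
    newU N n h \ diaFN N (newL N n h) = {.u n (by omega)} := by
  have hE {i} (hi : i ∈ N) : Even i := (hNE hi).2
  ext x
  rw [newL_of_mem hNE hn hN, newU_of_mem hn hN, Set.mem_sdiff, mem_diaFN]
  cases x <;> simp [adjFN, posEven]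
  grind

theorem newU_diff_of_notMem (hNE : N ⊆ posEven) (hn : n ∈ posEven) (hN : n ∉ N)
    (h : 0 < n - 1) : newU N n h \ diaFN N (newL N n h) = ∅ := by
  rw [newL_of_notMem hNE hn.2 hN, newU_of_notMem hn.2 hN, Set.sdiff_eq_empty,
    Set.singleton_subset_iff, mem_diaFN]
  exact ⟨_, rfl, .inr (.inr (.inr (.inr ⟨hn, hN, rfl⟩)))⟩

theorem inter_dia_newL_of_mem (hNE : N ⊆ posEven) (hn : Even n) (hN : n ∈ N) (h : 0 < n - 1) :
    newU N n h ∩ diaFN N (newL N n h) = {.u (n + 1) (by omega)} := by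
  have hE {i} (hi : i ∈ N) : Even i := (hNE hi).2
  ext x
  rw [newL_of_mem hNE hn hN, newU_of_mem hn hN, Set.mem_inter_iff, mem_diaFN]
  cases x <;> simp [adjFN, posEven]
  grind

theorem dia_newL_diff_of_notMem (hNE : N ⊆ posEven) (hn : n ∈ posEven) (hN : n ∉ N)
    (h : 0 < n - 1) :
    (diaFN N (newL N n h) ∩ layerFive) \ newU N n h = {.u (n + 1) (by omega)} := by
  have hE {i} (hi : i ∈ N) : Even i := (hNE hi).2
  have hn' := hn.2
  ext x
  rw [newL_of_notMem hNE hn' hN, newU_of_notMem hn' hN, Set.mem_sdiff, Set.mem_inter_iff,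
    mem_diaFN]
  cases x <;> simp [adjFN, layerFive, posEven]
  grind

/-- The vertex `ℓₙ₊₁` sees only `uₙ₊₁` among the `uᵢ`, whereas `ℓₙ₊₂` also sees `uₙ₊₂`, which lies
outside `newU`. -/
theorem newL_inter_dia_of_mem (hNE : N ⊆ posEven) (hn : Even n) (hN : n ∈ N) (h : 0 < n - 1) :
    newL N n h ∩ diaFN N ((diaFN N (newL N n h) ∩ layerFive) \ newU N n h) = {.l (n + 2)} := by
  have hE {i} (hi : i ∈ N) : Even i := (hNE hi).2
  rw [newL_of_mem hNE hn hN, newU_of_mem hn hN]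
  refine Set.eq_singleton_iff_unique_mem.2 ⟨⟨.inr rfl, mem_diaFN_of_adj (y := .u (n + 2) (by omega))
    ⟨⟨mem_diaFN_of_adj (y := .l (n + 2)) (.inr rfl) (.inl rfl), .inr ⟨_, _, rfl⟩⟩, by simp⟩
    (.inl rfl)⟩, ?_⟩
  rintro x ⟨rfl | rfl, hx⟩
  · exfalso
    obtain ⟨y, ⟨⟨-, hy⟩, hy'⟩, hxy⟩ := mem_diaFN.1 hx
    cases y <;> simp [adjFN, layerFive, posEven] at hxy hy hy'
    grind
  · rfl

theorem dia_u_of_notMem (hNE : N ⊆ posEven) (hn : Even n) (hN : n ∉ N) :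
    (diaFN N {.u (n + 1) (by omega)} ∩ layerFour) \ {.l (n + 1)} = {.l (n + 2)} := by
  have hE {i} (hi : i ∈ N) : Even i := (hNE hi).2
  ext x
  rw [Set.mem_sdiff, Set.mem_inter_iff, mem_diaFN]
  cases x <;> simp [adjFN, layerFour, posEven]
  grind

theorem layerFour_diff_dia_layerFive (hNE : N ⊆ posEven) :
    layerFour \ diaFN N layerFive = {.b₃, .l 0} := by
  -- Otherwise `ℓ₀` would be adjacent to `u₁`.
  have h0 : 0 ∉ N := fun h => (hNE h).1.false
  ext x
  rw [Set.mem_sdiff, mem_diaFN]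
  cases x with
  | l i =>
    rcases Nat.eq_zero_or_pos i with rfl | hi
    · refine iff_of_true ⟨.inr (.inr ⟨_, rfl⟩), ?_⟩ (.inr rfl)
      rintro ⟨_, rfl | ⟨j, hj, rfl⟩, h | h⟩
      · exact Vert.noConfusion h
      · exact h
      · exact Vert.noConfusion h
      · rcases h with h | ⟨-, h⟩ | ⟨h, -⟩ | ⟨-, -, h⟩
        exacts [by omega, by omega, h0 h, by omega]
    · refine iff_of_false (fun h => h.2 ⟨.u i hi, .inr ⟨_, _, rfl⟩, .inr (.inl rfl)⟩) ?_
      simp [hi.ne']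
  | _ => simp [adjFN, layerFour, layerFive]

theorem dia_b₃_l_zero : (diaFN N {.b₃, .l 0} ∩ layerFour) \ {.b₃, .l 0} = {.l 1} := by
  ext x
  rw [Set.mem_sdiff, Set.mem_inter_iff, mem_diaFN]
  cases x <;> simp [adjFN, layerFour]
  omega

theorem dia_l_one (hNE : N ⊆ posEven) : diaFN N {.l 1} ∩ layerFive = {.u 1 one_pos} := by
  have hE {i} (hi : i ∈ N) : Even i := (hNE hi).2
  ext x
  rw [Set.mem_inter_iff, mem_diaFN]
  cases x <;> simp [adjFN, layerFive, posEven]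
  grind

theorem dia_u_one (hNE : N ⊆ posEven) :
    (diaFN N {.u 1 one_pos} ∩ layerFour) \ {.l 1} = {.l 2} := by
  have hE {i} (hi : i ∈ N) : 0 < i ∧ Even i := hNE hi
  ext x
  rw [Set.mem_sdiff, Set.mem_inter_iff, mem_diaFN]
  cases x <;> simp [adjFN, layerFour, posEven]
  grind

end Steps

namespace Definable

variable {M N : Set ℕ} {n : ℕ}

theorem newU {h : 0 < n - 1} (hl : Definable M N {.l n} {.l n})
    (hu : Definable M N {.u (n - 1) h} {.u (n - 1) h}) :
    Definable M N (newU M n h) (newU N n h) :=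
  (hl.dia.inter layerFive).diff hu

theorem newL {h : 0 < n - 1} (hl : Definable M N {.l n} {.l n})
    (hu : Definable M N {.u (n - 1) h} {.u (n - 1) h}) :
    Definable M N (newL M n h) (newL N n h) :=
  ((newU hl hu).dia.inter layerFour).diff hl

theorem u_one (hM : M ⊆ posEven) (hN : N ⊆ posEven) :
    Definable M N {.u 1 one_pos} {.u 1 one_pos} ∧ Definable M N {.l 2} {.l 2} := by
  have h0 : Definable M N {.b₃, .l 0} {.b₃, .l 0} := by
    have := (layerFour (M := M) (N := N)).diff layerFive.dia
    rwa [layerFour_diff_dia_layerFive hM, layerFour_diff_dia_layerFive hN] at this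
  have h1 : Definable M N {.l 1} {.l 1} := by
    have := (h0.dia.inter layerFour).diff h0
    rwa [dia_b₃_l_zero, dia_b₃_l_zero] at this
  have h2 : Definable M N {.u 1 one_pos} {.u 1 one_pos} := by
    have := h1.dia.inter layerFive
    rwa [dia_l_one hM, dia_l_one hN] at this
  have h3 := (h2.dia.inter layerFour).diff h1
  rw [dia_u_one hM, dia_u_one hN] at h3
  exact ⟨h2, h3⟩

/-- The defining terms depend on whether `n` is in the set, so agreement at `n` is what lets one
term serve both graphs. -/
theorem succ (hM : M ⊆ posEven) (hN : N ⊆ posEven) (hn : n ∈ posEven) (hMN : n ∈ M ↔ n ∈ N)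
    {h : 0 < n - 1} (hu : Definable M N {.u (n - 1) h} {.u (n - 1) h})
    (hl : Definable M N {.l n} {.l n}) :
    Definable M N {.u (n + 1) n.succ_pos} {.u (n + 1) n.succ_pos} ∧
      Definable M N {.l (n + 2)} {.l (n + 2)} := by
  have hL := newL hl hu
  have hU := newU hl hu
  by_cases hmem : n ∈ N
  · have hmem' := hMN.2 hmem
    have h1 := hU.inter hL.dia
    have h2 := hL.inter (((hL.dia.inter layerFive).diff hU).dia)
    rw [inter_dia_newL_of_mem hM hn.2 hmem', inter_dia_newL_of_mem hN hn.2 hmem] at h1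
    rw [newL_inter_dia_of_mem hM hn.2 hmem', newL_inter_dia_of_mem hN hn.2 hmem] at h2
    exact ⟨h1, h2⟩
  · have hmem' := mt hMN.1 hmem
    have h1 := (hL.dia.inter layerFive).diff hU
    rw [dia_newL_diff_of_notMem hM hn hmem', dia_newL_diff_of_notMem hN hn hmem] at h1
    have h2 := (h1.dia.inter layerFour).diff hL
    rw [newL_of_notMem hM hn.2 hmem', newL_of_notMem hN hn.2 hmem,
      dia_u_of_notMem hM hn.2 hmem', dia_u_of_notMem hN hn.2 hmem] at h2
    exact ⟨h1, h2⟩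

/-- The strict bound matters: `2 * m + 2` itself may be the first point of disagreement. -/
theorem u_l (hM : M ⊆ posEven) (hN : N ⊆ posEven) (m : ℕ)
    (hMN : ∀ i < 2 * m + 2, i ∈ M ↔ i ∈ N) :
    Definable M N {.u (2 * m + 1) (2 * m).succ_pos} {.u (2 * m + 1) (2 * m).succ_pos} ∧
      Definable M N {.l (2 * m + 2)} {.l (2 * m + 2)} := by
  induction m with
  | zero => exact u_one hM hN
  | succ m ih =>
    obtain ⟨h1, h2⟩ := ih fun i hi => hMN i (by omega)
    exact succ (n := 2 * m + 2) (h := by omega) hM hN ⟨by omega, m + 1, by omega⟩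
      (hMN _ (by omega)) h1 h2

/-- A term that vanishes at `d` in `Cm(F_M)` but not in `Cm(F_N)`. -/
theorem empty_singleton (hM : M ⊆ posEven) (hN : N ⊆ posEven) (hnM : n ∉ M) (hnN : n ∈ N)
    (hMN : ∀ i < n, i ∈ M ↔ i ∈ N) : ∃ B, B.Nonempty ∧ Definable M N ∅ B := by
  have hn := hN hnN
  obtain ⟨m, rfl⟩ : ∃ m, n = 2 * m + 2 := by
    obtain ⟨hpos, k, hk⟩ := hn
    exact ⟨k - 1, by omega⟩
  obtain ⟨hu, hl⟩ := u_l hM hN m hMN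
  have h : 0 < 2 * m + 2 - 1 := by omega
  have := (newU (h := h) hl hu).diff (newL hl hu).dia
  rw [newU_diff_of_notMem hM hn hnM, newU_diff_of_mem hN hn.2 hnN] at this
  exact ⟨_, Set.singleton_nonempty _, this⟩

end Definable

/-! ### Separating the varieties -/

/-- A term that vanishes on a set of vertices of `F_N` only if the set is `{d}`. -/
def termD : KTBTerm :=
  -- By the diameter bound, the complement of `◇⁵` of a set vanishes exactly when the set is
  -- nonempty; this encodes the existence of a vertex at distance five.
  .sup (.compl (.diaPow 5 (.sdiff (.diaPow 5 .var) (.diaPow 4 .var))))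
    (.sdiff (.sdiff (.diaPow 3 .var) (.diaPow 2 .var))
      (.dia (.sdiff (.diaPow 4 .var) (.diaPow 3 .var))))

/-- The set of vertices that is the value of a term at a set of vertices. -/
def KTBTerm.evalFN (N : Set ℕ) (t : KTBTerm) (X : Set Vert) : Set Vert :=
  KTBTerm.eval (A := Cm (graphFN N)) X t

theorem evalFN_termD (N : Set ℕ) (X : Set Vert) : termD.evalFN N X = ∅ ↔
    diaFN N (diaFN N (diaFN N (diaFN N (diaFN N
      (diaFN N (diaFN N (diaFN N (diaFN N (diaFN N X)))) \
        diaFN N (diaFN N (diaFN N (diaFN N X)))))))) = Set.univ ∧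
    diaFN N (diaFN N (diaFN N X)) \ diaFN N (diaFN N X) ⊆
      diaFN N (diaFN N (diaFN N (diaFN N (diaFN N X))) \ diaFN N (diaFN N (diaFN N X))) :=
  Set.compl_empty_iff.trans <| inf_eq_top_iff.trans <|
    and_congr (Eq.congr_left (compl_compl (α := Set Vert) _))
      (Set.compl_univ_iff.trans Set.sdiff_eq_empty)

theorem eq_singleton_d_of_termD {N : Set ℕ} {X : Set Vert} (h : termD.evalFN N X = ∅) :
    X = {Vert.d} := by
  rw [evalFN_termD] at h
  refine eq_singleton_d (Set.nonempty_iff_ne_empty.2 fun h0 => ?_) h.2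
  have := h.1
  rw [h0] at this
  simp only [diaFN, Set.mem_empty_iff_false, false_and, exists_false, Set.ofPred_false] at this
  exact Set.notMem_empty Vert.d (this ▸ Set.mem_univ _)

theorem termD_d (N : Set ℕ) : termD.evalFN N {.d} = ∅ := by
  rw [evalFN_termD, diaFN_d, diaFN_two_d, diaFN_three_d, diaFN_four_d, diaFN_five_d]
  constructor
  · apply diaFN_five_eq_univ
    exact ⟨.c₂, trivial, fun h => h (.inl rfl)⟩
  · rw [← layerFour_eq]
    rintro x ⟨rfl | hx, hx'⟩
    · exact mem_diaFN_of_adj (y := .b₃) (.inr (.inl rfl)) trivial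
    · exact absurd hx hx'

theorem algD_notMem_Var {M N : Set ℕ} {n : ℕ} (hM : M ⊆ posEven) (hN : N ⊆ posEven)
    (hnM : n ∉ M) (hnN : n ∈ N) (hMN : ∀ i < n, i ∈ M ↔ i ∈ N) :
    algD N ∉ KTBAlg.Var {algD M} := by
  intro hmem
  obtain ⟨B, hB, w, hwM, hwN⟩ := Definable.empty_singleton hM hN hnM hnN hMN
  have hN' := KTBAlg.eval_eq_bot_of_mem_Var (.sdiff w (.diaPow 5 termD)) ?_ hmem
    ⟨elemD N, fun L hL => hL rfl⟩
  · have h := (KTBTerm.eval_coe _ _ _).symm.trans (congrArg Subtype.val hN')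
    have h' : (B \ diaFN N (diaFN N (diaFN N (diaFN N (diaFN N (termD.evalFN N {.d})))))) =
        (∅ : Set Vert) := by
      rw [← hwN]
      exact h
    rw [termD_d] at h'
    simp [diaFN] at h'
    exact hB.ne_empty h'
  · rintro _ rfl ⟨X, hX⟩
    apply Subtype.ext
    refine (KTBTerm.eval_coe _ _ _).trans ?_
    change w.evalFN M X \ diaFN M (diaFN M (diaFN M (diaFN M (diaFN M (termD.evalFN M X))))) =
      (∅ : Set Vert)
    -- Either `X` is `{d}`, where `w` vanishes, or `◇⁵` of the value of `termD` is everything and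
    -- the difference is empty.
    rcases Set.eq_empty_or_nonempty (termD.evalFN M X) with h | h
    · obtain rfl : X = ({.d} : Set Vert) := eq_singleton_d_of_termD h
      have : w.evalFN M {.d} = ∅ := hwM
      rw [this, Set.empty_sdiff]
    · rw [diaFN_five_eq_univ h, Set.sdiff_univ]

theorem mainTheorem3 (M N : Set ℕ) (hM : M ⊆ posEven) (hN : N ⊆ posEven) (hMN : M ≠ N) :
    KTBAlg.Var {algD M} ≠ KTBAlg.Var {algD N} := by
  intro h
  have hex : ∃ n, ¬(n ∈ M ↔ n ∈ N) := by
    by_contra! hall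
    exact hMN (Set.ext hall)
  classical
  have hlt (i) (hi : i < Nat.find hex) : i ∈ M ↔ i ∈ N := not_not.1 (Nat.find_min hex hi)
  -- The variety of the algebra whose index set omits the least difference satisfies the identity,
  -- and the other algebra refutes it.
  by_cases hn : Nat.find hex ∈ N
  · have hnM : Nat.find hex ∉ M := fun h' => Nat.find_spec hex ⟨fun _ => hn, fun _ => h'⟩
    exact algD_notMem_Var hM hN hnM hn hlt (h ▸ KTBAlg.mem_Var_self _)
  · have hnM : Nat.find hex ∈ M := by
      by_contra h'
      exact Nat.find_spec hex ⟨fun h1 => absurd h1 h', fun h1 => absurd h1 hn⟩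
    exact algD_notMem_Var hN hM hn hnM (fun i hi => (hlt i hi).symm) (h ▸ KTBAlg.mem_Var_self _)
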